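/- Rings are associative with unit, and homomorphisms preserve the unit. Let $f\colon A\to B$ be a ring epimorphism (an epimorphism in the category of rings) that is 1-finite, i.e. via $f$ the ring $B$ is a finitely presented left $A$-module of projective dimension at most one. For a set $\Sigma$ of maps between finitely generated projective left $A$-modules, $f$ is called the universal localisation of $A$ at $\Sigma$ if $B\otimes_A\sigma$ is an isomorphism for every $\sigma\in\Sigma$ and every ring homomorphism $g\colon A\to C$ such that $C\otimes_A\sigma$ is an isomorphism for all $\sigma\in\Sigma$ factors as $g=hf$ for a unique ring homomorphism $h\colon B\to C$; in other words, $B\cong A_\Sigma$ compatibly with the maps from $A$. Let $K_f$ be the complex of left $A$-modules $A\xrightarrow{f}B$ with $A$ in degree $-1$ and $B$ in degree $0$. Say that a map $g\colon P\to Q$ between finitely generated projective left $A$-modules resolves $K_f$ if there is a quasi-isomorphism to $K_f$ from the complex $P\xrightarrow{g}Q$ (with $P$ in degree $-1$ and $Q$ in degree $0$). Then: 1. $f$ is homological, i.e. $\operatorname{Tor}_i^A(B,B)=0$ for all $i>0$, if and only if $f$ is a universal localisation of $A$ at some set $\Sigma$ of maps between finitely generated projective left $A$-modules. 2. There exists a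 map $g$ between finitely generated projective left $A$-modules that resolves $K_f$. 3. If $f$ is homological, then for every map $g$ between finitely generated projective left $A$-modules that resolves $K_f$, $f$ is the universal localisation of $A$ at $\{g\}$; that is, $B\cong A_{\{g\}}$ compatibly with the maps from $A$. -/

import Mathlib

universe u

namespace RingEpi

open CategoryTheory CategoryTheory.Limits TensorProduct

noncomputable section

/-! ### Tensor product over a (noncommutative) ring, and Tor -/

section Tensor

variable {A : Type u} [Ring A]

/-- The subgroup of `X ⊗_ℤ M` generated by the elements `x a ⊗ m - x ⊗ a m`.
Right `A`-modules are modules over `Aᵐᵒᵖ`. -/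
def balancedRelations (X : ModuleCat.{u} Aᵐᵒᵖ) (M : ModuleCat.{u} A) :
    Submodule ℤ (X ⊗[ℤ] M) :=
  Submodule.span ℤ {t | ∃ (x : X) (a : A) (m : M),
    t = (MulOpposite.op a • x) ⊗ₜ[ℤ] m - x ⊗ₜ[ℤ] (a • m)}

/-- The abelian group `X ⊗_A M`, for a right `A`-module `X` and a left `A`-module `M`. -/
abbrev TensorOver (X : ModuleCat.{u} Aᵐᵒᵖ) (M : ModuleCat.{u} A) : Type u :=
  (X ⊗[ℤ] M) ⧸ balancedRelations X M

theorem balancedRelations_le_comap (X : ModuleCat.{u} Aᵐᵒᵖ) {M N : ModuleCat.{u} A}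
    (φ : M ⟶ N) :
    balancedRelations X M ≤ (balancedRelations X N).comap
      (TensorProduct.map (LinearMap.id : X →ₗ[ℤ] X) (φ.hom.toAddMonoidHom.toIntLinearMap)) := by
  refine Submodule.span_le.2 ?_
  rintro _ ⟨x, a, m, rfl⟩
  exact Submodule.subset_span ⟨x, a, φ.hom m, by simp⟩

/-- The homomorphism `X ⊗_A φ : X ⊗_A M → X ⊗_A N`, `x ⊗ m ↦ x ⊗ φ m`. -/
def TensorOver.map (X : ModuleCat.{u} Aᵐᵒᵖ) {M N : ModuleCat.{u} A} (φ : M ⟶ N) :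
    TensorOver X M →ₗ[ℤ] TensorOver X N :=
  Submodule.mapQ _ _
    (TensorProduct.map (LinearMap.id : X →ₗ[ℤ] X) (φ.hom.toAddMonoidHom.toIntLinearMap))
    (balancedRelations_le_comap X φ)

theorem TensorOver.map_id (X : ModuleCat.{u} Aᵐᵒᵖ) (M : ModuleCat.{u} A) :
    TensorOver.map X (𝟙 M) = LinearMap.id :=
  Submodule.linearMap_qext _ (TensorProduct.ext' fun _ _ => rfl)

theorem TensorOver.map_comp (X : ModuleCat.{u} Aᵐᵒᵖ) {M N L : ModuleCat.{u} A}
    (φ : M ⟶ N) (ψ : N ⟶ L) :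
    TensorOver.map X (φ ≫ ψ) = (TensorOver.map X ψ).comp (TensorOver.map X φ) :=
  Submodule.linearMap_qext _ (TensorProduct.ext' fun _ _ => rfl)

theorem TensorOver.map_add (X : ModuleCat.{u} Aᵐᵒᵖ) {M N : ModuleCat.{u} A} (φ ψ : M ⟶ N) :
    TensorOver.map X (φ + ψ) = TensorOver.map X φ + TensorOver.map X ψ :=
  Submodule.linearMap_qext _ (TensorProduct.ext' fun x m =>
    congrArg (Submodule.Quotient.mk (p := balancedRelations X N))
      (TensorProduct.tmul_add x (φ.hom m) (ψ.hom m)))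

/-- The functor `X ⊗_A -` from left `A`-modules to abelian groups. -/
def tensorFunctor (X : ModuleCat.{u} Aᵐᵒᵖ) : ModuleCat.{u} A ⥤ ModuleCat.{u} ℤ where
  obj M := ModuleCat.of ℤ (TensorOver X M)
  map φ := ModuleCat.ofHom (TensorOver.map X φ)
  map_id M := by rw [TensorOver.map_id]; rfl
  map_comp φ ψ := by rw [TensorOver.map_comp]; rfl

instance tensorFunctor_additive (X : ModuleCat.{u} Aᵐᵒᵖ) : (tensorFunctor X).Additive where
  map_add {_ _ φ ψ} := congrArg ModuleCat.ofHom (TensorOver.map_add X φ ψ)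

/-- `Tor_n^A(X, M)`: the value at `M` of the `n`-th left derived functor of `X ⊗_A -`. -/
def torGroup (n : ℕ) (X : ModuleCat.{u} Aᵐᵒᵖ) (M : ModuleCat.{u} A) : ModuleCat.{u} ℤ :=
  ((tensorFunctor X).leftDerived n).obj M

end Tensor

/-! ### Ring homomorphisms -/

section RingHoms

variable {A B : Type u} [Ring A] [Ring B]

/-- `B` as a left `A`-module via `f`, i.e. `a • b = f a * b`. -/
abbrev leftMod (f : A →+* B) : ModuleCat.{u} A :=
  (ModuleCat.restrictScalars f).obj (ModuleCat.of B B)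

/-- `B` as a right `A`-module via `f`, i.e. `b • a = b * f a`. -/
abbrev rightMod (f : A →+* B) : ModuleCat.{u} Aᵐᵒᵖ :=
  (ModuleCat.restrictScalars f.op).obj (ModuleCat.of Bᵐᵒᵖ B)

/-- `f` as a homomorphism of left `A`-modules `A → B`. -/
def asModuleHom (f : A →+* B) : ModuleCat.of A A ⟶ leftMod f :=
  ModuleCat.ofHom (Y := leftMod f)
    { toFun := fun a => f a
      map_add' := fun a b => map_add f a b
      map_smul' := fun a b => map_mul f a b }

/-- A ring epimorphism: an epimorphism in the category of unital rings. -/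
def IsRingEpi (f : A →+* B) : Prop := Epi (RingCat.ofHom f)

/-- A `1`-finite ring epimorphism. -/
structure IsOneFinite (f : A →+* B) : Prop where
  epi : IsRingEpi f
  finitePresentation : Module.FinitePresentation A (leftMod f)
  projectiveDimension_le_one : HasProjectiveDimensionLE (leftMod f) 1

/-- A homological ring epimorphism. -/
structure IsHomological (f : A →+* B) : Prop where
  epi : IsRingEpi f
  tor_eq_zero : ∀ i : ℕ, 0 < i → IsZero (torGroup i (rightMod f) (leftMod f))

/-- A map between finitely generated projective left `A`-modules. -/
def IsFGProjMap {P Q : ModuleCat.{u} A} (_ : P ⟶ Q) : Prop :=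
  (Module.Finite A P ∧ Module.Projective A P) ∧ (Module.Finite A Q ∧ Module.Projective A Q)

/-- `B ⊗_A σ` is an isomorphism. (It is a map of left `B`-modules, so it is invertible as such
exactly when it is invertible as a map of abelian groups.) -/
def Inverts (f : A →+* B) {P Q : ModuleCat.{u} A} (σ : P ⟶ Q) : Prop :=
  IsIso ((tensorFunctor (rightMod f)).map σ)

/-- `f : A → B` is the universal localisation `A → A_S` of `A` at the set `S` of maps between
finitely generated projective left `A`-modules. -/
structure IsUniversalLocalisationAt (f : A →+* B) (S : Set (Arrow (ModuleCat.{u} A))) :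
    Prop where
  fgProj : ∀ σ ∈ S, IsFGProjMap σ.hom
  inverts : ∀ σ ∈ S, Inverts f σ.hom
  existsUnique_lift : ∀ (C : Type u) [Ring C] (g : A →+* C),
    (∀ σ ∈ S, Inverts g σ.hom) → ∃! h : B →+* C, h.comp f = g

/-- `f` is a universal localisation (at some set of maps). -/
def IsUniversalLocalisation (f : A →+* B) : Prop :=
  ∃ S : Set (Arrow (ModuleCat.{u} A)), IsUniversalLocalisationAt f S

/-- The complex `P → Q` of left `A`-modules, with `P` in degree `-1` and `Q` in degree `0`. -/
def twoTerm {P Q : ModuleCat.{u} A} (g : P ⟶ Q) : CochainComplex (ModuleCat.{u} A) ℤ :=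
  HomologicalComplex.double g (c := ComplexShape.up ℤ) (i₀ := -1) (i₁ := 0) (by simp)

/-- The complex `K_f`, namely `f : A → B` with `A` in degree `-1`. -/
def coneComplex (f : A →+* B) : CochainComplex (ModuleCat.{u} A) ℤ :=
  twoTerm (asModuleHom f)

/-- `g` is a map between finitely generated projective left `A`-modules such that the complex
`g : P → Q` admits a quasi-isomorphism to `K_f`. -/
def ResolvesCone (f : A →+* B) {P Q : ModuleCat.{u} A} (g : P ⟶ Q) : Prop :=
  IsFGProjMap g ∧ ∃ φ : twoTerm g ⟶ coneComplex f, QuasiIso φ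

end RingHoms

end

end RingEpi

namespace RingEpi

open CategoryTheory CategoryTheory.Limits TensorProduct

section Tensor

variable {A : Type u} [Ring A]

namespace TensorOver

/-- The class of `x ⊗ m` in `X ⊗_A M`. -/
def tmul {X : ModuleCat.{u} Aᵐᵒᵖ} {M : ModuleCat.{u} A} (x : X) (m : M) : TensorOver X M :=
  Submodule.Quotient.mk (x ⊗ₜ[ℤ] m)

variable {X : ModuleCat.{u} Aᵐᵒᵖ} {M N L : ModuleCat.{u} A}

theorem tmul_add (x : X) (m m' : M) : tmul x (m + m') = tmul x m + tmul x m' :=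
  congrArg (Submodule.Quotient.mk (p := balancedRelations X M)) (TensorProduct.tmul_add x m m')

theorem add_tmul (x x' : X) (m : M) : tmul (x + x') m = tmul x m + tmul x' m :=
  congrArg (Submodule.Quotient.mk (p := balancedRelations X M)) (TensorProduct.add_tmul x x' m)

theorem smul_tmul (x : X) (a : A) (m : M) :
    tmul (MulOpposite.op a • x) m = tmul x (a • m) :=
  (Submodule.Quotient.eq _).2 (Submodule.subset_span ⟨x, a, m, rfl⟩)

@[simp]
theorem map_tmul (φ : M ⟶ N) (x : X) (m : M) :
    TensorOver.map X φ (tmul x m) = tmul x (φ.hom m) := rfl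

theorem induction_on {motive : TensorOver X M → Prop} (t : TensorOver X M)
    (zero : motive 0) (tmul : ∀ x m, motive (tmul x m))
    (add : ∀ s t, motive s → motive t → motive (s + t)) : motive t := by
  obtain ⟨t, rfl⟩ := Submodule.Quotient.mk_surjective _ t
  induction t with
  | zero => exact zero
  | tmul x m => exact tmul x m
  | add s t hs ht => exact add _ _ hs ht

theorem addHom_ext {G : Type*} [AddCommGroup G] {φ ψ : TensorOver X M →+ G}
    (h : ∀ x m, φ (tmul x m) = ψ (tmul x m)) : φ = ψ := by
  ext t
  induction t using induction_on with
  | zero => simp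
  | tmul x m => exact h x m
  | add s t hs ht => simp [hs, ht]

/-- The homomorphism out of `X ⊗_A M` defined by a balanced biadditive map. -/
def lift {G : Type*} [AddCommGroup G] (b : X →+ M →+ G)
    (hb : ∀ x (a : A) m, b (MulOpposite.op a • x) m = b x (a • m)) : TensorOver X M →+ G :=
  ((balancedRelations X M).liftQ
    (TensorProduct.liftAddHom b (fun r x m => by simp)).toIntLinearMap
    (Submodule.span_le.2 (by
      rintro _ ⟨x, a, m, rfl⟩
      simp [hb]))).toAddMonoidHom

theorem map_surjective {φ : M ⟶ N} (h : Function.Surjective φ.hom) :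
    Function.Surjective (TensorOver.map X φ) := by
  intro t
  induction t using induction_on with
  | zero => exact ⟨0, map_zero _⟩
  | tmul x n =>
    obtain ⟨m, rfl⟩ := h n
    exact ⟨tmul x m, rfl⟩
  | add s t hs ht =>
    obtain ⟨s, rfl⟩ := hs
    obtain ⟨t, rfl⟩ := ht
    exact ⟨s + t, _root_.map_add _ _ _⟩

/-- Right exactness of `X ⊗_A -`. -/
theorem map_exact {φ : M ⟶ N} {ψ : N ⟶ L} (h : Function.Exact φ.hom ψ.hom)
    (hψ : Function.Surjective ψ.hom) :
    Function.Exact (TensorOver.map X φ) (TensorOver.map X ψ) := by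
  set φ' : M →ₗ[ℤ] N := φ.hom.toAddMonoidHom.toIntLinearMap
  set ψ' : N →ₗ[ℤ] L := ψ.hom.toAddMonoidHom.toIntLinearMap
  have hZ : Function.Exact (LinearMap.lTensor X φ') (LinearMap.lTensor X ψ') :=
    lTensor_exact X h hψ
  intro t
  constructor
  · intro ht
    obtain ⟨t, rfl⟩ := Submodule.Quotient.mk_surjective _ t
    have h1 : LinearMap.lTensor X ψ' t ∈ balancedRelations X L :=
      (Submodule.Quotient.mk_eq_zero _).1 ht
    have h2 : balancedRelations X L ≤ (balancedRelations X N).map (LinearMap.lTensor X ψ') := by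
      refine Submodule.span_le.2 ?_
      rintro _ ⟨x, a, l, rfl⟩
      obtain ⟨n, rfl⟩ := hψ l
      exact ⟨_, Submodule.subset_span ⟨x, a, n, rfl⟩, by simp [ψ']⟩
    obtain ⟨r, hr, hrt⟩ := h2 h1
    obtain ⟨s, hs⟩ := (hZ (t - r)).1 (by rw [_root_.map_sub, hrt, sub_self])
    refine ⟨Submodule.Quotient.mk s, ?_⟩
    refine (Submodule.Quotient.eq _).2 ?_
    change LinearMap.lTensor X φ' s - t ∈ _
    rw [hs, sub_sub_cancel_left]
    exact neg_mem hr
  · rintro ⟨s, rfl⟩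
    have : φ ≫ ψ = 0 := by
      ext m
      exact h.apply_apply_eq_zero m
    have h0 : TensorOver.map X (φ ≫ ψ) = 0 := by
      rw [this]
      exact Submodule.linearMap_qext _ (TensorProduct.ext' fun x m =>
        congrArg (Submodule.Quotient.mk (p := balancedRelations X L)) (TensorProduct.tmul_zero _ x))
    rw [TensorOver.map_comp] at h0
    exact LinearMap.congr_fun h0 s

end TensorOver

end Tensor

section BaseChange

variable {A C : Type u} [Ring A] [Ring C] (h : A →+* C)

/-- The left `C`-module `C ⊗_A M`. -/
def BaseChange (M : ModuleCat.{u} A) : Type u := TensorOver (rightMod h) M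

namespace BaseChange

noncomputable instance (M : ModuleCat.{u} A) : AddCommGroup (BaseChange h M) :=
  inferInstanceAs (AddCommGroup (TensorOver (rightMod h) M))

variable {M N : ModuleCat.{u} A}

/-- The element `c ⊗ m` of `C ⊗_A M`. -/
noncomputable def tmul (c : C) (m : M) : BaseChange h M := TensorOver.tmul (X := rightMod h) c m

theorem tmul_add (c : C) (m m' : M) : tmul h c (m + m') = tmul h c m + tmul h c m' :=
  TensorOver.tmul_add (X := rightMod h) c m m'

theorem add_tmul (c c' : C) (m : M) : tmul h (c + c') m = tmul h c m + tmul h c' m :=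
  TensorOver.add_tmul (X := rightMod h) c c' m

theorem mul_tmul (c : C) (a : A) (m : M) : tmul h (c * h a) m = tmul h c (a • m) :=
  TensorOver.smul_tmul (X := rightMod h) c a m

theorem induction_on {motive : BaseChange h M → Prop} (t : BaseChange h M)
    (zero : motive 0) (tmul : ∀ c m, motive (tmul h c m))
    (add : ∀ s t, motive s → motive t → motive (s + t)) : motive t :=
  TensorOver.induction_on (X := rightMod h) (M := M) t zero tmul add

theorem addHom_ext {G : Type*} [AddCommGroup G] {φ ψ : BaseChange h M →+ G}
    (H : ∀ c m, φ (tmul h c m) = ψ (tmul h c m)) : φ = ψ :=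
  TensorOver.addHom_ext (X := rightMod h) (M := M) H

/-- The homomorphism out of `C ⊗_A M` defined by a balanced biadditive map. -/
noncomputable def liftAddHom {G : Type*} [AddCommGroup G] (b : C →+ M →+ G)
    (hb : ∀ c (a : A) m, b (c * h a) m = b c (a • m)) : BaseChange h M →+ G :=
  TensorOver.lift (X := rightMod h) (M := M) b hb

@[simp]
theorem liftAddHom_tmul {G : Type*} [AddCommGroup G] (b : C →+ M →+ G)
    (hb : ∀ c (a : A) m, b (c * h a) m = b c (a • m)) (c : C) (m : M) :
    liftAddHom h b hb (tmul h c m) = b c m := rfl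

/-- `tmul` as a biadditive map. -/
noncomputable def tmulHom (M : ModuleCat.{u} A) : C →+ M →+ BaseChange h M :=
  AddMonoidHom.mk' (fun c => AddMonoidHom.mk' (tmul h c) (tmul_add h c))
    (fun c c' => by ext m; exact add_tmul h c c' m)

@[simp]
theorem tmulHom_apply (c : C) (m : M) : tmulHom h M c m = tmul h c m := rfl

@[simp]
theorem zero_tmul (m : M) : tmul h 0 m = 0 :=
  DFunLike.congr_fun (map_zero (tmulHom h M)) m

/-- Left multiplication by `c` on the first factor of `C ⊗_A M`. -/
noncomputable def actionAux (M : ModuleCat.{u} A) (c : C) : BaseChange h M →+ BaseChange h M :=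
  liftAddHom h ((tmulHom h M).comp (AddMonoidHom.mulLeft c)) fun c' a m =>
    (congrArg (tmul h · m) (mul_assoc c c' (h a)).symm).trans (mul_tmul h (c * c') a m)

@[simp]
theorem actionAux_tmul (c d : C) (m : M) :
    actionAux h M c (tmul h d m) = tmul h (c * d) m := rfl

/-- The action of `C` on `C ⊗_A M` by left multiplication on the first factor. -/
noncomputable def action (M : ModuleCat.{u} A) : C →+* AddMonoid.End (BaseChange h M) where
  toFun := actionAux h M
  map_one' := addHom_ext h fun c m => by simp; rfl
  map_mul' c c' := addHom_ext h fun d m => by simp [mul_assoc]; rfl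
  map_zero' := addHom_ext h fun c m => by simp; rfl
  map_add' c c' := addHom_ext h fun d m => by simp [add_mul, add_tmul]; rfl

noncomputable instance (M : ModuleCat.{u} A) : Module C (BaseChange h M) :=
  Module.compHom _ (action h M)

@[simp]
theorem smul_tmul (c d : C) (m : M) : c • tmul h d m = tmul h (c * d) m := rfl

/-- The `h`-semilinear map `M → C ⊗_A M`, `m ↦ 1 ⊗ m`. -/
noncomputable def unit (M : ModuleCat.{u} A) : M →ₛₗ[h] BaseChange h M where
  toFun m := tmul h 1 m
  map_add' := tmul_add h 1
  map_smul' a m := by rw [← mul_tmul, smul_tmul]; simp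

theorem unit_apply (m : M) : unit h M m = tmul h 1 m := rfl

theorem smul_unit (c : C) (m : M) : c • unit h M m = tmul h c m := by
  rw [unit_apply, smul_tmul, mul_one]

variable {h} in
theorem hom_ext {N : Type*} [AddCommGroup N] [Module C N] {φ ψ : BaseChange h M →ₗ[C] N}
    (H : ∀ m, φ (unit h M m) = ψ (unit h M m)) : φ = ψ := by
  have : φ.toAddMonoidHom = ψ.toAddMonoidHom := addHom_ext h fun c m => by
    simp [← smul_unit, H]
  ext t
  exact DFunLike.congr_fun this t

variable {h} in
/-- The additive map underlying `BaseChange.lift`. -/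
noncomputable def liftAux {N : Type*} [AddCommGroup N] [Module C N] (α : M →ₛₗ[h] N) :
    BaseChange h M →+ N :=
  liftAddHom h (AddMonoidHom.mk' (fun c => AddMonoidHom.mk' (fun m => c • α m)
      (fun m m' => by rw [map_add, smul_add])) (fun c c' => by ext m; exact add_smul c c' (α m)))
    (fun c a m => (mul_smul c (h a) (α m)).trans (congrArg (c • ·) (map_smulₛₗ α a m).symm))

variable {h} in
@[simp]
theorem liftAux_tmul {N : Type*} [AddCommGroup N] [Module C N] (α : M →ₛₗ[h] N) (c : C) (m : M) :
    liftAux α (tmul h c m) = c • α m := rfl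

variable {h} in
/-- The `C`-linear extension to `C ⊗_A M` of an `h`-semilinear map out of `M`. -/
noncomputable def lift {N : Type*} [AddCommGroup N] [Module C N] (α : M →ₛₗ[h] N) :
    BaseChange h M →ₗ[C] N where
  toFun := liftAux α
  map_add' := map_add _
  map_smul' c t := by
    induction t using BaseChange.induction_on with
    | zero => simp
    | tmul d m => simp [mul_smul]
    | add s t hs ht => rw [smul_add, map_add, hs, ht, map_add, smul_add]

variable {h} in
@[simp]
theorem lift_unit {N : Type*} [AddCommGroup N] [Module C N] (α : M →ₛₗ[h] N) (m : M) :
    lift α (unit h M m) = α m :=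
  one_smul C (α m)

/-- The map `C ⊗_A σ : C ⊗_A M → C ⊗_A N`. -/
noncomputable def map (σ : M ⟶ N) : BaseChange h M →ₗ[C] BaseChange h N :=
  lift ((unit h N).comp σ.hom)

@[simp]
theorem map_unit (σ : M ⟶ N) (m : M) : map h σ (unit h M m) = unit h N (σ.hom m) :=
  lift_unit _ m

theorem map_tmul (σ : M ⟶ N) (c : C) (m : M) :
    map h σ (tmul h c m) = tmul h c (σ.hom m) := by
  rw [← smul_unit, map_smul, map_unit, smul_unit]

theorem map_apply (σ : M ⟶ N) (t : BaseChange h M) :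
    map h σ t = TensorOver.map (rightMod h) σ t := by
  induction t using BaseChange.induction_on with
  | zero => simp; rfl
  | tmul c m => exact map_tmul h σ c m
  | add s t hs ht => rw [map_add, hs, ht]; exact (map_add (TensorOver.map (rightMod h) σ) s t).symm

end BaseChange

theorem inverts_iff_bijective_tensor {P Q : ModuleCat.{u} A} (σ : P ⟶ Q) :
    Inverts h σ ↔ Function.Bijective (TensorOver.map (rightMod h) σ) :=
  ConcreteCategory.isIso_iff_bijective _

theorem inverts_iff_bijective {P Q : ModuleCat.{u} A} (σ : P ⟶ Q) :
    Inverts h σ ↔ Function.Bijective (BaseChange.map h σ) := by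
  rw [inverts_iff_bijective_tensor]
  exact iff_of_eq (congrArg _ (funext fun t => (BaseChange.map_apply h σ t).symm))

variable {h}

/-- The modules `N` such that every `h`-semilinear map `P → N` extends uniquely along `σ`. -/
def IsLocalFor {P Q : ModuleCat.{u} A} (σ : P ⟶ Q) (h : A →+* C)
    (N : Type u) [AddCommGroup N] [Module C N] : Prop :=
  Function.Bijective fun β : Q →ₛₗ[h] N => (β.comp σ.hom : P →ₛₗ[h] N)

theorem isLocalFor_of_inverts {P Q : ModuleCat.{u} A} {σ : P ⟶ Q} (hσ : Inverts h σ)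
    (N : Type u) [AddCommGroup N] [Module C N] : IsLocalFor σ h N := by
  let e := LinearEquiv.ofBijective _ ((inverts_iff_bijective h σ).1 hσ)
  have he (p : P) : e.symm (BaseChange.unit h Q (σ.hom p)) = BaseChange.unit h P p := by
    rw [LinearEquiv.symm_apply_eq]
    exact (BaseChange.map_unit h σ p).symm
  constructor
  · intro β β' hβ
    have : (BaseChange.lift β).comp e.toLinearMap = (BaseChange.lift β').comp e.toLinearMap := by
      refine BaseChange.hom_ext fun p => ?_
      simp only [LinearMap.comp_apply, LinearEquiv.coe_coe, e, LinearEquiv.ofBijective_apply,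
        BaseChange.map_unit, BaseChange.lift_unit]
      exact DFunLike.congr_fun hβ p
    ext q
    have := DFunLike.congr_fun this (e.symm (BaseChange.unit h Q q))
    simpa using this
  · intro α
    refine ⟨((BaseChange.lift α).comp e.symm.toLinearMap).comp (BaseChange.unit h Q), ?_⟩
    ext p
    simp [he]

theorem IsLocalFor.inverts {P Q : ModuleCat.{u} A} {σ : P ⟶ Q}
    (hP : IsLocalFor σ h (BaseChange h P)) (hQ : IsLocalFor σ h (BaseChange h Q)) :
    Inverts h σ := by
  obtain ⟨β, hβ⟩ := hP.2 (BaseChange.unit h P)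
  have hβ' (p : P) : β (σ.hom p) = BaseChange.unit h P p := DFunLike.congr_fun hβ p
  have h1 : (BaseChange.lift β).comp (BaseChange.map h σ) = LinearMap.id :=
    BaseChange.hom_ext fun p => by simp [hβ']
  have h2 : (BaseChange.map h σ).comp β = BaseChange.unit h Q := hQ.1 (by
    ext p
    simp [hβ'])
  have h3 : (BaseChange.map h σ).comp (BaseChange.lift β) = LinearMap.id :=
    BaseChange.hom_ext fun q => by simpa using DFunLike.congr_fun h2 q
  exact (inverts_iff_bijective h σ).2 (Function.bijective_iff_has_inverse.2
    ⟨BaseChange.lift β, DFunLike.congr_fun h1, DFunLike.congr_fun h3⟩)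

theorem IsLocalFor.of_retract {P Q : ModuleCat.{u} A} {σ : P ⟶ Q} {N M : Type u}
    [AddCommGroup N] [Module C N] [AddCommGroup M] [Module C M] {ι : Type}
    (hN : IsLocalFor σ h N) (s : M →ₗ[C] ι → N) (r : (ι → N) →ₗ[C] M)
    (hrs : ∀ m, r (s m) = m) : IsLocalFor σ h M := by
  constructor
  · intro β β' hβ
    ext q
    rw [← hrs (β q), ← hrs (β' q)]
    congr 1
    ext i
    have : ((LinearMap.proj i).comp s).comp β = ((LinearMap.proj i).comp s).comp β' := hN.1 (by
      ext p
      have := DFunLike.congr_fun hβ p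
      simp only [LinearMap.comp_apply] at this ⊢
      rw [this])
    exact DFunLike.congr_fun this q
  · intro α
    choose β hβ using fun i => hN.2 (((LinearMap.proj i).comp s).comp α)
    let γ : Q →ₛₗ[h] ι → N :=
      { toFun := fun q i => β i q
        map_add' := fun q q' => by ext i; simp
        map_smul' := fun a q => by ext i; simp }
    refine ⟨r.comp γ, ?_⟩
    ext p
    have : γ (σ.hom p) = s (α p) := by
      ext i
      exact DFunLike.congr_fun (hβ i) p
    simp [this, hrs]

theorem IsLocalFor.baseChange {P Q : ModuleCat.{u} A} {σ : P ⟶ Q} (hC : IsLocalFor σ h C)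
    (M : ModuleCat.{u} A) [Module.Finite A M] [Module.Projective A M] :
    IsLocalFor σ h (BaseChange h M) := by
  obtain ⟨n, p, i, -, -, hpi⟩ := Module.Finite.exists_comp_eq_id_of_projective A M
  let s : BaseChange h M →ₗ[C] Fin n → C := BaseChange.lift
    { toFun := fun m j => h (i m j)
      map_add' := fun m m' => by ext j; simp
      map_smul' := fun a m => by ext j; simp }
  let r : (Fin n → C) →ₗ[C] BaseChange h M :=
    Fintype.linearCombination C (fun j => BaseChange.unit h M (p (Pi.single j 1)))
  refine hC.of_retract s r fun t => ?_
  suffices r.comp s = LinearMap.id from DFunLike.congr_fun this t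
  refine BaseChange.hom_ext fun m => ?_
  have hm : m = ∑ j, i m j • p (Pi.single j 1) := by
    conv_lhs => rw [← LinearMap.id_apply (R := A) m, ← hpi, LinearMap.comp_apply,
      pi_eq_sum_univ' (i m)]
    simp [map_sum]
  simp only [LinearMap.comp_apply, s, r, BaseChange.lift_unit, Fintype.linearCombination_apply,
    LinearMap.id_apply]
  conv_rhs => rw [hm, map_sum]
  simp

/-- For maps between finitely generated projectives it suffices to test `N = C`. -/
theorem IsLocalFor.inverts_of_fgProj {P Q : ModuleCat.{u} A} {σ : P ⟶ Q}
    (hσ : IsFGProjMap σ) (hC : IsLocalFor σ h C) : Inverts h σ := by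
  obtain ⟨⟨_, _⟩, _, _⟩ := hσ
  exact (hC.baseChange P).inverts (hC.baseChange Q)

end BaseChange

section TwoTerm

variable {A : Type u} [Ring A]

theorem quasiIso_iff_ker_of_f_eq_zero {S₁ S₂ : ShortComplex (ModuleCat.{u} A)} (φ : S₁ ⟶ S₂)
    (h₁ : S₁.f = 0) (h₂ : S₂.f = 0) :
    ShortComplex.QuasiIso φ ↔
      (∀ x, S₁.g.hom x = 0 → φ.τ₂.hom x = 0 → x = 0) ∧
      (∀ y, S₂.g.hom y = 0 → ∃ x, S₁.g.hom x = 0 ∧ φ.τ₂.hom x = y) := by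
  have hg (x : S₁.X₂) : S₂.g.hom (φ.τ₂.hom x) = φ.τ₃.hom (S₁.g.hom x) :=
    ConcreteCategory.congr_hom φ.comm₂₃ x
  let k : LinearMap.ker S₁.g.hom →ₗ[A] LinearMap.ker S₂.g.hom :=
    φ.τ₂.hom.restrict fun x hx => by
      rw [LinearMap.mem_ker] at hx ⊢
      rw [hg, hx, map_zero]
  have hk := (ShortComplex.LeftHomologyMapData.ofIsLimitKernelFork φ h₁ _
    (ModuleCat.kernelIsLimit S₁.g) h₂ _ (ModuleCat.kernelIsLimit S₂.g)
    (ModuleCat.ofHom k) rfl).quasiIso_iff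
  rw [hk]
  refine (ConcreteCategory.isIso_iff_bijective (ModuleCat.ofHom k)).trans (and_congr ?_ ?_)
  · refine (injective_iff_map_eq_zero k).trans ⟨fun H x hx hx' => ?_, fun H x hx => ?_⟩
    · exact congrArg Subtype.val (H ⟨x, hx⟩ (Subtype.ext hx'))
    · exact Subtype.ext (H x.1 x.2 (congrArg Subtype.val hx))
  · refine ⟨fun H y hy => ?_, fun H y => ?_⟩
    · obtain ⟨x, hx⟩ := H ⟨y, hy⟩
      exact ⟨x.1, x.2, congrArg Subtype.val hx⟩
    · obtain ⟨x, hx, hxy⟩ := H y.1 y.2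
      exact ⟨⟨x, hx⟩, Subtype.ext hxy⟩

theorem quasiIso_iff_coker_of_g_eq_zero {S₁ S₂ : ShortComplex (ModuleCat.{u} A)} (φ : S₁ ⟶ S₂)
    (h₁ : S₁.g = 0) (h₂ : S₂.g = 0) :
    ShortComplex.QuasiIso φ ↔
      (∀ z y, φ.τ₂.hom z = S₂.f.hom y → ∃ x, S₁.f.hom x = z) ∧
      (∀ w, ∃ z y, φ.τ₂.hom z + S₂.f.hom y = w) := by
  have hf (x : S₁.X₁) : S₂.f.hom (φ.τ₁.hom x) = φ.τ₂.hom (S₁.f.hom x) :=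
    ConcreteCategory.congr_hom φ.comm₁₂ x
  let k : (S₁.X₂ ⧸ LinearMap.range S₁.f.hom) →ₗ[A] (S₂.X₂ ⧸ LinearMap.range S₂.f.hom) :=
    Submodule.mapQ _ _ φ.τ₂.hom (by
      rintro _ ⟨x, rfl⟩
      exact ⟨_, hf x⟩)
  have hk := (ShortComplex.RightHomologyMapData.ofIsColimitCokernelCofork φ h₁ _
    (ModuleCat.cokernelIsColimit S₁.f) h₂ _ (ModuleCat.cokernelIsColimit S₂.f)
    (ModuleCat.ofHom k) rfl).quasiIso_iff
  rw [hk]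
  refine (ConcreteCategory.isIso_iff_bijective (ModuleCat.ofHom k)).trans (and_congr ?_ ?_)
  · refine (injective_iff_map_eq_zero k).trans ⟨fun H z y hz => ?_, fun H t ht => ?_⟩
    · refine (Submodule.Quotient.mk_eq_zero _).1
        (H (Submodule.Quotient.mk z) ((Submodule.Quotient.mk_eq_zero _).2 ⟨y, hz.symm⟩))
    · obtain ⟨z, rfl⟩ := Submodule.Quotient.mk_surjective _ t
      obtain ⟨y, hy⟩ := (Submodule.Quotient.mk_eq_zero _).1 ht
      exact (Submodule.Quotient.mk_eq_zero _).2 (H z y hy.symm)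
  · refine ⟨fun H w => ?_, fun H t => ?_⟩
    · obtain ⟨t, ht⟩ := H (Submodule.Quotient.mk w)
      obtain ⟨z, rfl⟩ := Submodule.Quotient.mk_surjective _ t
      obtain ⟨y, hy⟩ := (Submodule.Quotient.eq _).1 ht
      refine ⟨z, -y, ?_⟩
      rw [map_neg, hy]
      abel
    · obtain ⟨w, rfl⟩ := Submodule.Quotient.mk_surjective _ t
      obtain ⟨z, y, rfl⟩ := H w
      refine ⟨Submodule.Quotient.mk z, (Submodule.Quotient.eq _).2 ⟨-y, ?_⟩⟩
      rw [map_neg]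
      abel

variable {P Q P' Q' : ModuleCat.{u} A} {g' : P' ⟶ Q'} {g : P ⟶ Q}

/-- The term `P` of `twoTerm (g : P ⟶ Q)`. -/
noncomputable def twoTermIsoLeft (g : P ⟶ Q) : (twoTerm g).X (-1) ≅ P :=
  HomologicalComplex.doubleXIso₀ g _

/-- The term `Q` of `twoTerm (g : P ⟶ Q)`. -/
noncomputable def twoTermIsoRight (g : P ⟶ Q) : (twoTerm g).X 0 ≅ Q :=
  HomologicalComplex.doubleXIso₁ g _ (by simp)

theorem twoTerm_d (g : P ⟶ Q) :
    (twoTerm g).d (-1) 0 = (twoTermIsoLeft g).hom ≫ g ≫ (twoTermIsoRight g).inv :=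
  HomologicalComplex.double_d g _ (by simp)

theorem isZero_twoTerm_X (g : P ⟶ Q) (k : ℤ) (h₀ : k ≠ -1) (h₁ : k ≠ 0) :
    IsZero ((twoTerm g).X k) :=
  HomologicalComplex.isZero_double_X g _ k h₀ h₁

/-- The component `P ⟶ P'` of a map of two-term complexes. -/
noncomputable def leftComp (φ : twoTerm g ⟶ twoTerm g') : P ⟶ P' :=
  (twoTermIsoLeft g).inv ≫ φ.f (-1) ≫ (twoTermIsoLeft g').hom

theorem hom_leftComp (φ : twoTerm g ⟶ twoTerm g') :
    (twoTermIsoLeft g).hom ≫ leftComp φ = φ.f (-1) ≫ (twoTermIsoLeft g').hom := by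
  simp [leftComp]

/-- The component `Q ⟶ Q'` of a map of two-term complexes. -/
noncomputable def rightComp (φ : twoTerm g ⟶ twoTerm g') : Q ⟶ Q' :=
  (twoTermIsoRight g).inv ≫ φ.f 0 ≫ (twoTermIsoRight g').hom

theorem hom_rightComp (φ : twoTerm g ⟶ twoTerm g') :
    (twoTermIsoRight g).hom ≫ rightComp φ = φ.f 0 ≫ (twoTermIsoRight g').hom := by
  simp [rightComp]

theorem leftComp_comp (φ : twoTerm g ⟶ twoTerm g') : leftComp φ ≫ g' = g ≫ rightComp φ := by
  have := φ.comm (-1) 0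
  rw [twoTerm_d, twoTerm_d] at this
  simp only [leftComp, rightComp, Category.assoc]
  rw [Iso.inv_comp_eq, ← cancel_mono (twoTermIsoRight g').inv]
  simpa using this

/-- The map of two-term complexes given by a commutative square. -/
theorem exists_twoTerm_hom (p : P ⟶ P') (q : Q ⟶ Q') (w : p ≫ g' = g ≫ q) :
    ∃ φ : twoTerm g ⟶ twoTerm g', leftComp φ = p ∧ rightComp φ = q := by
  have h₁ : (p ≫ (twoTermIsoLeft g').inv) ≫ (twoTerm g').d (-1) 0 =
      g ≫ q ≫ (twoTermIsoRight g').inv := by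
    rw [twoTerm_d]
    simp [reassoc_of% w]
  have h₂ (k : ℤ) (hk : (ComplexShape.up ℤ).Rel 0 k) :
      (q ≫ (twoTermIsoRight g').inv) ≫ (twoTerm g').d 0 k = 0 := by
    obtain rfl : k = 1 := by simpa using hk.symm
    exact (isZero_twoTerm_X g' 1 (by simp) (by simp)).eq_of_tgt _ _
  let φ : twoTerm g ⟶ twoTerm g' := HomologicalComplex.mkHomFromDouble _ (by simp) _ _ h₁ h₂
  have hφ₁ : φ.f (-1) = (twoTermIsoLeft g).hom ≫ p ≫ (twoTermIsoLeft g').inv :=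
    HomologicalComplex.mkHomFromDouble_f₀ ..
  have hφ₀ : φ.f 0 = (twoTermIsoRight g).hom ≫ q ≫ (twoTermIsoRight g').inv :=
    HomologicalComplex.mkHomFromDouble_f₁ ..
  exact ⟨φ, by simp [leftComp, hφ₁], by simp [rightComp, hφ₀]⟩

theorem quasiIsoAt_neg_one_iff (φ : twoTerm g ⟶ twoTerm g') :
    QuasiIsoAt φ (-1) ↔
      (∀ x, g.hom x = 0 → (leftComp φ).hom x = 0 → x = 0) ∧
      (∀ y, g'.hom y = 0 → ∃ x, g.hom x = 0 ∧ (leftComp φ).hom x = y) := by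
  rw [quasiIsoAt_iff' φ (-2) (-1) 0 (by simp) (by simp)]
  let S {P Q : ModuleCat.{u} A} (g : P ⟶ Q) : ShortComplex (ModuleCat.{u} A) :=
    ShortComplex.mk (0 : (twoTerm g).X (-2) ⟶ P) g zero_comp
  let e {P Q : ModuleCat.{u} A} (g : P ⟶ Q) : (twoTerm g).sc' (-2) (-1) 0 ≅ S g :=
    ShortComplex.isoMk (Iso.refl _) (twoTermIsoLeft g) (twoTermIsoRight g)
      ((isZero_twoTerm_X g (-2) (by simp) (by simp)).eq_of_src _ _)
      (by
        change _ = (twoTerm g).d (-1) 0 ≫ _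
        rw [twoTerm_d]
        simp [S]
        rfl)
  let ψ : S g ⟶ S g' :=
    { τ₁ := φ.f (-2)
      τ₂ := leftComp φ
      τ₃ := rightComp φ
      comm₁₂ := by simp [S]
      comm₂₃ := leftComp_comp φ }
  refine (ShortComplex.quasiIso_iff_of_arrow_mk_iso _ ψ (Arrow.isoMk (e g) (e g') (by
    ext1
    · exact (Category.id_comp _).trans (Category.comp_id _).symm
    · exact hom_leftComp φ
    · exact hom_rightComp φ))).trans ?_
  exact quasiIso_iff_ker_of_f_eq_zero ψ rfl rfl

theorem quasiIsoAt_zero_iff (φ : twoTerm g ⟶ twoTerm g') :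
    QuasiIsoAt φ 0 ↔
      (∀ z y, (rightComp φ).hom z = g'.hom y → ∃ x, g.hom x = z) ∧
      (∀ w, ∃ z y, (rightComp φ).hom z + g'.hom y = w) := by
  rw [quasiIsoAt_iff' φ (-1) 0 1 (by simp) (by simp)]
  let S {P Q : ModuleCat.{u} A} (g : P ⟶ Q) : ShortComplex (ModuleCat.{u} A) :=
    ShortComplex.mk g (0 : Q ⟶ (twoTerm g).X 1) comp_zero
  let e {P Q : ModuleCat.{u} A} (g : P ⟶ Q) : (twoTerm g).sc' (-1) 0 1 ≅ S g :=
    ShortComplex.isoMk (twoTermIsoLeft g) (twoTermIsoRight g) (Iso.refl _)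
      (by
        change _ = (twoTerm g).d (-1) 0 ≫ _
        rw [twoTerm_d]
        simp [S]
        rfl)
      ((isZero_twoTerm_X g 1 (by simp) (by simp)).eq_of_tgt _ _)
  let ψ : S g ⟶ S g' :=
    { τ₁ := leftComp φ
      τ₂ := rightComp φ
      τ₃ := φ.f 1
      comm₁₂ := leftComp_comp φ
      comm₂₃ := by simp [S] }
  refine (ShortComplex.quasiIso_iff_of_arrow_mk_iso _ ψ (Arrow.isoMk (e g) (e g') (by
    ext1
    · exact hom_leftComp φ
    · exact hom_rightComp φ
    · exact (Category.id_comp _).trans (Category.comp_id _).symm))).trans ?_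
  exact quasiIso_iff_coker_of_g_eq_zero ψ rfl rfl

theorem quasiIso_twoTerm_iff (φ : twoTerm g ⟶ twoTerm g') :
    QuasiIso φ ↔ QuasiIsoAt φ (-1) ∧ QuasiIsoAt φ 0 := by
  refine ⟨fun _ => ⟨inferInstance, inferInstance⟩, fun ⟨h₁, h₀⟩ => ⟨fun k => ?_⟩⟩
  by_cases hk : k = -1
  · exact hk ▸ h₁
  by_cases hk' : k = 0
  · exact hk' ▸ h₀
  rw [quasiIsoAt_iff_exactAt']
  · exact ShortComplex.exact_of_isZero_X₂ _ (isZero_twoTerm_X g k hk hk')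
  · exact ShortComplex.exact_of_isZero_X₂ _ (isZero_twoTerm_X g' k hk hk')

end TwoTerm

section Tor

variable {A : Type u} [Ring A]

/-- The chain complex `P → Q`, with `Q` in degree `0`. -/
noncomputable abbrev twoTermChain {P Q : ModuleCat.{u} A} (d : P ⟶ Q) :
    ChainComplex (ModuleCat.{u} A) ℕ :=
  HomologicalComplex.double d (c := ComplexShape.down ℕ) (i₀ := 1) (i₁ := 0) (by simp)

/-- The projective resolution given by a short exact sequence `0 → P → Q → M → 0`. -/
theorem exists_projectiveResolution {P Q M : ModuleCat.{u} A} (d : P ⟶ Q) (ε : Q ⟶ M)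
    [Projective P] [Projective Q] (hd : Function.Injective d.hom)
    (hε : Function.Surjective ε.hom) (hdε : Function.Exact d.hom ε.hom) :
    ∃ R : ProjectiveResolution M, R.complex = twoTermChain d := by
  have h0 : d ≫ ε = 0 := by
    ext x
    exact hdε.apply_apply_eq_zero x
  let e₁ := HomologicalComplex.doubleXIso₀ d (c := ComplexShape.down ℕ) (i₀ := 1) (i₁ := 0)
    (by simp)
  let e₀ := HomologicalComplex.doubleXIso₁ d (c := ComplexShape.down ℕ) (i₀ := 1) (i₁ := 0)
    (by simp) (by simp)
  have hdd : (twoTermChain d).d 1 0 = e₁.hom ≫ d ≫ e₀.inv :=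
    HomologicalComplex.double_d d _ (by simp)
  have hz (n : ℕ) : IsZero ((twoTermChain d).X (n + 2)) :=
    HomologicalComplex.isZero_double_X d _ (n + 2) (by simp) (by simp)
  have hddε : (twoTermChain d).d 1 0 ≫ e₀.hom ≫ ε = 0 := by simp [hdd, h0]
  have hπ := (ChainComplex.toSingle₀Equiv_symm_apply_f_zero _ hddε).symm.trans
    (Category.comp_id _).symm
  have hdd' : e₁.hom ≫ d = (twoTermChain d).d 1 0 ≫ e₀.hom := by simp [hdd]
  refine ⟨
    { complex := twoTermChain d
      projective := ?_
      π := (ChainComplex.toSingle₀Equiv _ _).symm ⟨e₀.hom ≫ ε, hddε⟩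
      quasiIso := ⟨?_⟩ }, rfl⟩
  · rintro (_ | _ | n)
    · exact Projective.of_iso e₀.symm inferInstance
    · exact Projective.of_iso e₁.symm inferInstance
    · exact Projective.of_iso (hz n).isoZero.symm inferInstance
  · rintro (_ | _ | n)
    · rw [ChainComplex.quasiIsoAt₀_iff, ShortComplex.quasiIso_iff_of_zeros']
      · refine (ShortComplex.exact_and_epi_g_iff_of_iso
          (S₂ := ShortComplex.mk d ε h0) ?_).2 ⟨?_, ?_⟩
        · exact ShortComplex.isoMk e₁ e₀ (Iso.refl _) hdd' hπ
        · exact (ShortComplex.ShortExact.moduleCat_exact_iff_function_exact _).2 hdε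
        · exact (ModuleCat.epi_iff_surjective _).2 hε
      · exact (twoTermChain d).shape 0 0 (by simp)
      · rfl
      · rfl
    · rw [quasiIsoAt_iff_exactAt' _ _ (ChainComplex.exactAt_succ_single_obj _ _),
        HomologicalComplex.exactAt_iff' _ 2 1 0 (by simp) (by simp),
        ShortComplex.exact_iff_mono _ ((hz 0).eq_of_src _ _)]
      change Mono ((twoTermChain d).d 1 0)
      rw [hdd]
      have : Mono d := (ModuleCat.mono_iff_injective _).2 hd
      infer_instance
    · rw [quasiIsoAt_iff_exactAt' _ _ (ChainComplex.exactAt_succ_single_obj _ _)]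
      exact ShortComplex.exact_of_isZero_X₂ _ (hz n)

theorem isZero_torGroup_iff {P Q M : ModuleCat.{u} A} (d : P ⟶ Q) (ε : Q ⟶ M)
    [Projective P] [Projective Q] (hd : Function.Injective d.hom)
    (hε : Function.Surjective ε.hom) (hdε : Function.Exact d.hom ε.hom)
    (n : ℕ) (X : ModuleCat.{u} Aᵐᵒᵖ) :
    IsZero (torGroup n X M) ↔
      (((tensorFunctor X).mapHomologicalComplex _).obj (twoTermChain d)).ExactAt n := by
  obtain ⟨R, hR⟩ := exists_projectiveResolution d ε hd hε hdε
  rw [HomologicalComplex.exactAt_iff_isZero_homology, ← hR]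
  exact (R.isoLeftDerivedObj (tensorFunctor X) n).isZero_iff

theorem isZero_torGroup_add_two {P Q M : ModuleCat.{u} A} (d : P ⟶ Q) (ε : Q ⟶ M)
    [Projective P] [Projective Q] (hd : Function.Injective d.hom)
    (hε : Function.Surjective ε.hom) (hdε : Function.Exact d.hom ε.hom)
    (n : ℕ) (X : ModuleCat.{u} Aᵐᵒᵖ) :
    IsZero (torGroup (n + 2) X M) := by
  rw [isZero_torGroup_iff d ε hd hε hdε]
  exact ShortComplex.exact_of_isZero_X₂ _ ((tensorFunctor X).map_isZero
    (HomologicalComplex.isZero_double_X d _ (n + 2) (by simp) (by simp)))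

theorem isZero_torGroup_one_iff {P Q M : ModuleCat.{u} A} (d : P ⟶ Q) (ε : Q ⟶ M)
    [Projective P] [Projective Q] (hd : Function.Injective d.hom)
    (hε : Function.Surjective ε.hom) (hdε : Function.Exact d.hom ε.hom)
    (X : ModuleCat.{u} Aᵐᵒᵖ) :
    IsZero (torGroup 1 X M) ↔ Function.Injective (TensorOver.map X d) := by
  have hz : IsZero ((twoTermChain d).X 2) :=
    HomologicalComplex.isZero_double_X d _ 2 (by simp) (by simp)
  rw [isZero_torGroup_iff d ε hd hε hdε,
    HomologicalComplex.exactAt_iff' _ 2 1 0 (by simp) (by simp),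
    ShortComplex.exact_iff_mono _ (((tensorFunctor X).map_isZero hz).eq_of_src _ _)]
  change Mono ((tensorFunctor X).map ((twoTermChain d).d 1 0)) ↔ _
  rw [HomologicalComplex.double_d d _ (by simp), Functor.map_comp, Functor.map_comp]
  refine Iff.trans ?_ (ModuleCat.mono_iff_injective ((tensorFunctor X).map d))
  exact (MorphismProperty.monomorphisms _).cancel_left_of_respectsIso _ _ |>.trans
    ((MorphismProperty.monomorphisms _).cancel_right_of_respectsIso _ _)

end Tor

section Epi

variable {A B : Type u} [Ring A] [Ring B] {f : A →+* B}

/-- Restriction of scalars along a ring epimorphism is full. -/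
theorem IsRingEpi.map_smul (hf : IsRingEpi f) {M N : Type u} [AddCommGroup M] [AddCommGroup N]
    [Module B M] [Module B N] (φ : M →+ N) (hφ : ∀ a m, φ (f a • m) = f a • φ m) (b : B) (m : M) :
    φ (b • m) = b • φ m := by
  let v (ψ : M →+ N) : AddMonoid.End (M × N) :=
    (AddMonoidHom.fst M N).prod (AddMonoidHom.snd M N + ψ.comp (AddMonoidHom.fst M N))
  have hv (ψ : M →+ N) (x : M × N) : v ψ x = (x.1, x.2 + ψ x.1) := rfl
  let ρ : B →+* AddMonoid.End (M × N) := Module.toAddMonoidEnd B (M × N)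
  have hρ (b : B) (x : M × N) : ρ b x = (b • x.1, b • x.2) := rfl
  let ρ' : B →+* AddMonoid.End (M × N) :=
    { toFun := fun b => v φ * ρ b * v (-φ)
      map_one' := by
        ext x <;> simp [hv]
      map_mul' := fun b b' => by
        ext x <;> simp [hv, hρ]
      map_zero' := by
        ext x <;> simp
      map_add' := fun b b' => by
        rw [map_add, mul_add, add_mul] }
  have hρ' (b : B) (x : M × N) : ρ' b x = v φ (ρ b (v (-φ) x)) := rfl
  have key : RingCat.ofHom f ≫ RingCat.ofHom ρ = RingCat.ofHom f ≫ RingCat.ofHom ρ' := by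
    ext a x <;> simp [hρ', hρ, hv, hφ]
  have : Epi (RingCat.ofHom f) := hf
  have h1 : ρ = ρ' := congrArg RingCat.Hom.hom ((cancel_epi _).1 key)
  have h2 := congrArg Prod.snd (DFunLike.congr_fun (DFunLike.congr_fun h1 b) (m, (0 : N)))
  simp only [hρ', hρ, hv] at h2
  simp only [smul_zero, zero_add, AddMonoidHom.neg_apply, smul_neg] at h2
  exact (neg_add_eq_zero.1 h2.symm).symm

theorem IsRingEpi.tensor_bijective (hf : IsRingEpi f) :
    Function.Bijective (TensorOver.map (rightMod f) (asModuleHom f)) := by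
  rw [← inverts_iff_bijective_tensor, inverts_iff_bijective]
  let μ : BaseChange f (leftMod f) →ₗ[B] B := BaseChange.lift
    { toFun := fun b => b
      map_add' := fun _ _ => rfl
      map_smul' := fun _ _ => rfl }
  let ν : B →ₗ[B] BaseChange f (ModuleCat.of A A) :=
    LinearMap.toSpanSingleton B _ (BaseChange.unit f (ModuleCat.of A A) (1 : A))
  have hμ (b : leftMod f) : μ (BaseChange.unit f _ b) = b := BaseChange.lift_unit _ b
  have h1 : (ν.comp μ).comp (BaseChange.map f (asModuleHom f)) = LinearMap.id := by
    refine BaseChange.hom_ext fun a => ?_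
    refine (congrArg (fun t => ν (μ t)) (BaseChange.map_unit f (asModuleHom f) a)).trans ?_
    refine (congrArg ν (hμ _)).trans ?_
    change f a • BaseChange.unit f (ModuleCat.of A A) (1 : A) = _
    rw [← map_smulₛₗ]
    exact congrArg _ (mul_one a)
  have h2 : (BaseChange.map f (asModuleHom f)).comp (ν.comp μ) = LinearMap.id := by
    refine BaseChange.hom_ext fun b => ?_
    simp only [LinearMap.comp_apply, hμ, LinearMap.id_apply]
    change BaseChange.map f (asModuleHom f)
      ((show B from b) • BaseChange.unit f (ModuleCat.of A A) (1 : A)) = _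
    rw [LinearMap.map_smul, BaseChange.map_unit]
    have h3 : (asModuleHom f).hom (1 : A) = (show leftMod f from (1 : B)) := map_one f
    rw [h3]
    refine (hf.map_smul (M := B) (BaseChange.unit f (leftMod f)).toAddMonoidHom
      (fun a b => (BaseChange.unit f (leftMod f)).map_smulₛₗ a b) b (1 : B)).symm.trans ?_
    exact congrArg (BaseChange.unit f (leftMod f)) (mul_one (show B from b))
  exact Function.bijective_iff_has_inverse.2
    ⟨ν.comp μ, DFunLike.congr_fun h1, DFunLike.congr_fun h2⟩

end Epi

section Cone

variable {A : Type u} [Ring A] {P Q R L : ModuleCat.{u} A}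

theorem TensorOver.map_zero (X : ModuleCat.{u} Aᵐᵒᵖ) (M N : ModuleCat.{u} A) :
    TensorOver.map X (0 : M ⟶ N) = 0 :=
  congrArg ModuleCat.Hom.hom ((tensorFunctor X).map_zero M N)

/-- The map `P → Q × R` with components `g` and `p`. -/
noncomputable def prodMap (g : P ⟶ Q) (p : P ⟶ R) : P ⟶ ModuleCat.of A (Q × R) :=
  ModuleCat.ofHom (g.hom.prod p.hom)

/-- The map `Q × R → L` with components `q` and `r`. -/
noncomputable def coprodMap (q : Q ⟶ L) (r : R ⟶ L) : ModuleCat.of A (Q × R) ⟶ L :=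
  ModuleCat.ofHom (q.hom.coprod r.hom)

theorem tensor_prodMap (X : ModuleCat.{u} Aᵐᵒᵖ) (g : P ⟶ Q) (p : P ⟶ R) (t : TensorOver X P) :
    TensorOver.map X (prodMap g p) t =
      TensorOver.map X (ModuleCat.ofHom (LinearMap.inl A Q R)) (TensorOver.map X g t) +
        TensorOver.map X (ModuleCat.ofHom (LinearMap.inr A Q R)) (TensorOver.map X p t) := by
  induction t using TensorOver.induction_on with
  | zero => simp only [_root_.map_zero, add_zero]
  | tmul x m =>
    simp only [TensorOver.map_tmul]
    refine Eq.trans ?_ (TensorOver.tmul_add _ _ _)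
    refine congrArg (TensorOver.tmul x) ?_
    exact Prod.ext (add_zero (g.hom m)).symm (zero_add (p.hom m)).symm
  | add s t hs ht =>
    simp only [_root_.map_add, hs, ht]
    abel

variable (X : ModuleCat.{u} Aᵐᵒᵖ) {g : P ⟶ Q} {p : P ⟶ R} {q : Q ⟶ L} {r : R ⟶ L}

theorem tensor_coprodMap_inl (z : TensorOver X Q) :
    TensorOver.map X (coprodMap q r)
      (TensorOver.map X (ModuleCat.ofHom (LinearMap.inl A Q R)) z) = TensorOver.map X q z := by
  rw [← LinearMap.comp_apply, ← TensorOver.map_comp]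
  congr 2
  ext x
  simp [coprodMap]

theorem tensor_coprodMap_inr (z : TensorOver X R) :
    TensorOver.map X (coprodMap q r)
      (TensorOver.map X (ModuleCat.ofHom (LinearMap.inr A Q R)) z) = TensorOver.map X r z := by
  rw [← LinearMap.comp_apply, ← TensorOver.map_comp]
  congr 2
  ext x
  simp [coprodMap]

theorem tensor_fst_inl (z : TensorOver X Q) :
    TensorOver.map X (ModuleCat.ofHom (LinearMap.fst A Q R))
      (TensorOver.map X (ModuleCat.ofHom (LinearMap.inl A Q R)) z) = z := by
  rw [← LinearMap.comp_apply, ← TensorOver.map_comp]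
  exact LinearMap.congr_fun (TensorOver.map_id X Q) z

theorem tensor_snd_inr (z : TensorOver X R) :
    TensorOver.map X (ModuleCat.ofHom (LinearMap.snd A Q R))
      (TensorOver.map X (ModuleCat.ofHom (LinearMap.inr A Q R)) z) = z := by
  rw [← LinearMap.comp_apply, ← TensorOver.map_comp]
  exact LinearMap.congr_fun (TensorOver.map_id X R) z

theorem tensor_fst_inr (z : TensorOver X R) :
    TensorOver.map X (ModuleCat.ofHom (LinearMap.fst A Q R))
      (TensorOver.map X (ModuleCat.ofHom (LinearMap.inr A Q R)) z) = 0 := by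
  rw [← LinearMap.comp_apply, ← TensorOver.map_comp]
  exact LinearMap.congr_fun (TensorOver.map_zero X R Q) z

theorem tensor_fst_prodMap (t : TensorOver X P) :
    TensorOver.map X (ModuleCat.ofHom (LinearMap.fst A Q R))
      (TensorOver.map X (prodMap g p) t) = TensorOver.map X g t := by
  rw [← LinearMap.comp_apply, ← TensorOver.map_comp]
  rfl

theorem tensor_prod_decomp (s : TensorOver X (ModuleCat.of A (Q × R))) :
    ∃ z y, s = TensorOver.map X (ModuleCat.ofHom (LinearMap.inl A Q R)) z +
        TensorOver.map X (ModuleCat.ofHom (LinearMap.inr A Q R)) y :=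
  ⟨_, _, (LinearMap.congr_fun (TensorOver.map_id X _) s).symm.trans
    (tensor_prodMap X (ModuleCat.ofHom (LinearMap.fst A Q R))
      (ModuleCat.ofHom (LinearMap.snd A Q R)) s)⟩

theorem tensor_bijective_left (hs : Function.Surjective (coprodMap q r).hom)
    (he : Function.Exact (prodMap g p).hom (coprodMap q r).hom)
    (hi : Function.Injective (TensorOver.map X (prodMap g p)))
    (hr : Function.Bijective (TensorOver.map X r)) : Function.Bijective (TensorOver.map X g) := by
  have hex := TensorOver.map_exact (X := X) he hs
  constructor
  · refine (injective_iff_map_eq_zero (TensorOver.map X g)).2 fun t ht => ?_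
    have h1 := hex.apply_apply_eq_zero t
    rw [tensor_prodMap, map_add, tensor_coprodMap_inl, tensor_coprodMap_inr, ht,
      _root_.map_zero, zero_add] at h1
    have h2 := (injective_iff_map_eq_zero _).1 hr.1 _ h1
    refine (injective_iff_map_eq_zero _).1 hi _ ?_
    rw [tensor_prodMap, ht, h2, _root_.map_zero, _root_.map_zero, add_zero]
  · intro z
    obtain ⟨y, hy⟩ := hr.2 (-TensorOver.map X q z)
    obtain ⟨t, ht⟩ := (hex (TensorOver.map X (ModuleCat.ofHom (LinearMap.inl A Q R)) z +
        TensorOver.map X (ModuleCat.ofHom (LinearMap.inr A Q R)) y)).1 (by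
      rw [map_add, tensor_coprodMap_inl, tensor_coprodMap_inr, hy, add_neg_cancel])
    refine ⟨t, ?_⟩
    rw [← tensor_fst_prodMap (p := p), ht, map_add, tensor_fst_inl, tensor_fst_inr, add_zero]

theorem tensor_bijective_right (hs : Function.Surjective (coprodMap q r).hom)
    (he : Function.Exact (prodMap g p).hom (coprodMap q r).hom)
    (hg : Function.Bijective (TensorOver.map X g)) : Function.Bijective (TensorOver.map X r) := by
  have hex := TensorOver.map_exact (X := X) he hs
  constructor
  · refine (injective_iff_map_eq_zero (TensorOver.map X r)).2 fun y hy => ?_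
    rw [← tensor_coprodMap_inr (q := q)] at hy
    obtain ⟨t, ht⟩ := (hex _).1 hy
    have h1 : TensorOver.map X g t = 0 := by
      rw [← tensor_fst_prodMap (p := p), ht, tensor_fst_inr]
    have h2 := (injective_iff_map_eq_zero _).1 hg.1 _ h1
    rw [← tensor_snd_inr (Q := Q) X y, ← ht, h2, _root_.map_zero, _root_.map_zero]
  · intro w
    obtain ⟨s, rfl⟩ := TensorOver.map_surjective (X := X) hs w
    obtain ⟨z, y, rfl⟩ := tensor_prod_decomp X s
    obtain ⟨t, rfl⟩ := hg.2 z
    refine ⟨y - TensorOver.map X p t, ?_⟩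
    have h1 := hex.apply_apply_eq_zero t
    rw [tensor_prodMap, map_add, tensor_coprodMap_inl, tensor_coprodMap_inr] at h1
    rw [map_add, tensor_coprodMap_inl, tensor_coprodMap_inr, map_sub, eq_neg_of_add_eq_zero_left h1]
    abel

end Cone

section Resolves

variable {A B : Type u} [Ring A] [Ring B] {f : A →+* B}

theorem ResolvesCone.exists_exact {P Q : ModuleCat.{u} A} {g : P ⟶ Q} (hg : ResolvesCone f g) :
    ∃ (p : P ⟶ ModuleCat.of A A) (q : Q ⟶ leftMod f),
      Function.Injective (prodMap g p).hom ∧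
      Function.Surjective (coprodMap q (asModuleHom f)).hom ∧
      Function.Exact (prodMap g p).hom (coprodMap q (asModuleHom f)).hom := by
  obtain ⟨-, φ, hφ⟩ := hg
  obtain ⟨h₁, h₀⟩ := (quasiIso_twoTerm_iff (g' := asModuleHom f) φ).1 hφ
  obtain ⟨hinj, hker⟩ := (quasiIsoAt_neg_one_iff (g' := asModuleHom f) φ).1 h₁
  obtain ⟨hcok, hsurj⟩ := (quasiIsoAt_zero_iff (g' := asModuleHom f) φ).1 h₀
  have hcomm (x : P) := ConcreteCategory.congr_hom (leftComp_comp (g' := asModuleHom f) φ) x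
  generalize leftComp (g' := asModuleHom f) φ = p at *
  generalize rightComp (g' := asModuleHom f) φ = q at *
  change ∀ x, (asModuleHom f).hom (p.hom x) = q.hom (g.hom x) at hcomm
  refine ⟨-p, q, ?_, ?_, ?_⟩
  · refine (injective_iff_map_eq_zero (prodMap g (-p)).hom).2 fun x hx => ?_
    exact hinj x (congrArg Prod.fst hx) (neg_eq_zero.1 (congrArg Prod.snd hx))
  · intro w
    obtain ⟨z, y, h⟩ := hsurj w
    exact ⟨(z, y), h⟩
  · rintro ⟨z, a⟩
    constructor
    · intro h
      have h' : q.hom z + (asModuleHom f).hom a = 0 := h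
      obtain ⟨x, rfl⟩ := hcok z (-a) (by rw [map_neg]; exact eq_neg_of_add_eq_zero_left h')
      rw [← hcomm, ← map_add] at h'
      obtain ⟨x', hx', hxa⟩ := hker _ h'
      refine ⟨x - x', ?_⟩
      refine Prod.ext ?_ ?_
      · change g.hom (x - x') = g.hom x
        rw [map_sub, hx', sub_zero]
      · change -p.hom (x - x') = a
        rw [map_sub, hxa]
        abel
    · rintro ⟨x, hx⟩
      rw [← hx]
      change q.hom (g.hom x) + (asModuleHom f).hom (-p.hom x) = 0
      rw [map_neg, hcomm, add_neg_cancel]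

theorem IsOneFinite.exists_resolvesCone (hf : IsOneFinite f) :
    ∃ (P Q : ModuleCat.{u} A) (g : P ⟶ Q), ResolvesCone f g := by
  obtain ⟨-, hfp, hpd⟩ := hf
  obtain ⟨n, m, ε, d, hε, hdε⟩ := Module.FinitePresentation.exists_fin' A (leftMod f)
  have hfg : Module.Finite A (LinearMap.ker ε) :=
    Module.Finite.iff_fg.2 (Module.FinitePresentation.fg_ker ε hε)
  have hproj : Module.Projective A (LinearMap.ker ε) := by
    rw [IsProjective.iff_projective, projective_iff_hasProjectiveDimensionLT_one]
    refine (LinearMap.shortExact_shortComplexKer hε).hasProjectiveDimensionLT_X₁ 1 ?_ hpd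
    have : Projective (ModuleCat.of A (Fin n → A)) :=
      (IsProjective.iff_projective (Fin n → A)).1 inferInstance
    exact inferInstanceAs (HasProjectiveDimensionLT (ModuleCat.of A (Fin n → A)) 1)
  obtain ⟨z, hz⟩ := hε (show leftMod f from (1 : B))
  have hs (a : A) : ε (a • z) = (asModuleHom f).hom a := by
    rw [map_smul, hz]
    exact mul_one (f a)
  let P := ModuleCat.of A (LinearMap.ker ε × A)
  let Q := ModuleCat.of A (Fin n → A)
  let g : P ⟶ Q := ModuleCat.ofHom
    ((LinearMap.ker ε).subtype.coprod (LinearMap.toSpanSingleton A _ z))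
  have hg (k : LinearMap.ker ε) (a : A) : g.hom (k, a) = k.1 + a • z := rfl
  let p : P ⟶ ModuleCat.of A A := ModuleCat.ofHom (LinearMap.snd A _ _)
  let q : Q ⟶ leftMod f := ModuleCat.ofHom (Y := leftMod f) ε
  obtain ⟨φ, hφ₁, hφ₀⟩ := exists_twoTerm_hom (g := g) (g' := asModuleHom f) p q (by
    refine ModuleCat.hom_ext (LinearMap.ext ?_)
    rintro ⟨k, a⟩
    change (asModuleHom f).hom a = ε (k.1 + a • z)
    rw [map_add, k.2, zero_add, hs])
  refine ⟨P, Q, g, ⟨⟨inferInstanceAs (Module.Finite A (LinearMap.ker ε × A)),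
    inferInstanceAs (Module.Projective A (LinearMap.ker ε × A))⟩,
    inferInstanceAs (Module.Finite A (Fin n → A)),
    inferInstanceAs (Module.Projective A (Fin n → A))⟩, φ, ?_⟩
  refine (quasiIso_twoTerm_iff (g' := asModuleHom f) φ).2
    ⟨(quasiIsoAt_neg_one_iff (g' := asModuleHom f) φ).2 ⟨?_, ?_⟩,
     (quasiIsoAt_zero_iff (g' := asModuleHom f) φ).2 ⟨?_, ?_⟩⟩
  · rintro ⟨k, a⟩ h h'
    rw [hφ₁] at h'
    obtain rfl : a = 0 := h'
    rw [hg, zero_smul, add_zero] at h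
    exact Prod.ext (Subtype.ext h) rfl
  · intro a ha
    refine ⟨(⟨-(a • z), ?_⟩, a), ?_, ?_⟩
    · rw [LinearMap.mem_ker, map_neg, hs, ha, neg_zero]
    · rw [hg, neg_add_cancel]
    · rw [hφ₁]
      rfl
  · intro y a h
    rw [hφ₀] at h
    refine ⟨(⟨y - a • z, ?_⟩, a), ?_⟩
    · rw [LinearMap.mem_ker, map_sub, hs, sub_eq_zero]
      exact h
    · rw [hg, sub_add_cancel]
  · intro w
    obtain ⟨y, hy⟩ := hε w
    refine ⟨y, 0, ?_⟩
    rw [hφ₀, map_zero, add_zero]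
    exact hy

end Resolves

section Universal

variable {A B : Type u} [Ring A] [Ring B] {f : A →+* B}

/-- If `C → C ⊗_A B` is bijective, then `A → C` factors through `A → B`. -/
theorem exists_comp_eq_of_bijective {C : Type u} [Ring C] (h : A →+* C)
    (hb : Function.Bijective (TensorOver.map (rightMod h) (asModuleHom f))) :
    ∃ k : B →+* C, k.comp f = h := by
  rw [← inverts_iff_bijective_tensor, inverts_iff_bijective] at hb
  let u (b : B) : BaseChange h (leftMod f) := BaseChange.unit h (leftMod f) b
  have hu_add (b b' : B) : u (b + b') = u b + u b' := map_add (BaseChange.unit h (leftMod f)) b b'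
  have hu_smul (a : A) (b : B) : u (f a * b) = h a • u b :=
    (BaseChange.unit h (leftMod f)).map_smulₛₗ a b
  let h' : ModuleCat.of A A →ₛₗ[h] C :=
    { toFun := fun a => h a
      map_add' := map_add h
      map_smul' := map_mul h }
  let μ : BaseChange h (ModuleCat.of A A) →ₗ[C] C := BaseChange.lift h'
  have hμ (a : A) : μ (BaseChange.unit h (ModuleCat.of A A) a) = h a :=
    BaseChange.lift_unit h' a
  have hmap (a : A) : BaseChange.map h (asModuleHom f) (BaseChange.unit h (ModuleCat.of A A) a) =
      u (f a) := BaseChange.map_unit h (asModuleHom f) a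
  have hinj (c c' : C) (hc : c • u 1 = c' • u 1) : c = c' := by
    rw [← map_one f, ← hmap, ← LinearMap.map_smul, ← LinearMap.map_smul] at hc
    have := congrArg μ (hb.1 hc)
    rwa [LinearMap.map_smul, LinearMap.map_smul, hμ, map_one, smul_eq_mul, smul_eq_mul, mul_one,
      mul_one] at this
  have hsurj (b : B) : ∃ c : C, c • u 1 = u b := by
    obtain ⟨t, ht⟩ := hb.2 (u b)
    refine ⟨μ t, ?_⟩
    rw [← ht]
    suffices (LinearMap.toSpanSingleton C _ (u 1)).comp μ = BaseChange.map h (asModuleHom f) from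
      DFunLike.congr_fun this t
    refine BaseChange.hom_ext fun a => ?_
    refine Eq.trans ?_ (hmap a).symm
    refine (congrArg (· • u 1) (hμ a)).trans ?_
    rw [← hu_smul, mul_one]
  choose θ hθ using hsurj
  have hmul (b c : B) : θ (b * c) = θ b * θ c := by
    let R : leftMod f ⟶ leftMod f := ModuleCat.ofHom (X := leftMod f) (Y := leftMod f)
      { toFun := fun x => (show B from x) * c
        map_add' := fun x y => add_mul (show B from x) y c
        map_smul' := fun a x => mul_assoc (f a) x c }
    have hR (x : B) : BaseChange.map h R (u x) = u (x * c) := BaseChange.map_unit h R x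
    apply hinj
    rw [hθ, ← hR, ← hθ b, LinearMap.map_smul, hR, one_mul, ← hθ c, mul_smul]
  refine ⟨
    { toFun := θ
      map_one' := hinj _ _ (by rw [hθ, one_smul])
      map_mul' := hmul
      map_zero' := hinj _ _ (by
        rw [hθ, zero_smul]
        exact map_zero (BaseChange.unit h (leftMod f)))
      map_add' := fun b c => hinj _ _ (by rw [hθ, hu_add, add_smul, hθ, hθ]) }, ?_⟩
  ext a
  refine hinj _ _ ?_
  change θ (f a) • u 1 = _
  rw [hθ, ← hu_smul, mul_one]

theorem IsRingEpi.hom_ext (hf : IsRingEpi f) {C : Type u} [Ring C] {k k' : B →+* C}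
    (h : k.comp f = k'.comp f) : k = k' := by
  have : Epi (RingCat.ofHom f) := hf
  refine congrArg RingCat.Hom.hom
    ((cancel_epi (RingCat.ofHom f) (g := RingCat.ofHom k) (h := RingCat.ofHom k')).1 ?_)
  exact congrArg RingCat.ofHom h

theorem projective_prod_self (Q : ModuleCat.{u} A) [Module.Projective A Q] :
    Projective (ModuleCat.of A (Q × ModuleCat.of A A)) :=
  (IsProjective.iff_projective _).1
    (inferInstanceAs (Module.Projective A (Q × A)))

theorem IsHomological.isUniversalLocalisationAt (hf : IsHomological f)
    {P Q : ModuleCat.{u} A} {g : P ⟶ Q} (hg : ResolvesCone f g) :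
    IsUniversalLocalisationAt f {Arrow.mk g} := by
  obtain ⟨p, q, hi, hs, he⟩ := hg.exists_exact
  obtain ⟨⟨_, _⟩, _, _⟩ := hg.1
  have : Projective P := (IsProjective.iff_projective P).1 inferInstance
  have := projective_prod_self Q
  refine ⟨?_, ?_, ?_⟩
  · rintro _ rfl
    exact hg.1
  · rintro _ rfl
    rw [inverts_iff_bijective_tensor]
    exact tensor_bijective_left (rightMod f) hs he
      ((isZero_torGroup_one_iff _ _ hi hs he _).1 (hf.tor_eq_zero 1 one_pos))
      hf.epi.tensor_bijective
  · intro C _ h hh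
    have hh := (inverts_iff_bijective_tensor h g).1 (hh _ rfl)
    obtain ⟨k, hk⟩ := exists_comp_eq_of_bijective h (tensor_bijective_right (rightMod h) hs he hh)
    exact ⟨k, hk, fun k' hk' => hf.epi.hom_ext (hk'.trans hk.symm)⟩

end Universal

section Extensions

variable {A : Type u} [Ring A] {P Q : ModuleCat.{u} A} {σ : P ⟶ Q}

/-- The modules that are local for `σ` are closed under extensions. -/
theorem IsLocalFor.extension {N E M : Type u} [AddCommGroup N] [AddCommGroup E] [AddCommGroup M]
    [Module A N] [Module A E] [Module A M] [Module.Projective A Q] {i : N →ₗ[A] E} {π : E →ₗ[A] M}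
    (hi : Function.Injective i) (hπ : Function.Surjective π) (hex : Function.Exact i π)
    (hN : IsLocalFor σ (RingHom.id A) N) (hM : IsLocalFor σ (RingHom.id A) M) :
    IsLocalFor σ (RingHom.id A) E := by
  have lift {X : ModuleCat.{u} A} (α : X →ₗ[A] E) (hα : ∀ x, π (α x) = 0) :
      ∃ δ : X →ₗ[A] N, ∀ x, i (δ x) = α x := by
    refine ⟨(LinearEquiv.ofInjective i hi).symm.toLinearMap.comp
      (α.codRestrict (LinearMap.range i) fun x => (hex _).1 (hα x)), fun x => ?_⟩
    exact congrArg Subtype.val ((LinearEquiv.ofInjective i hi).apply_symm_apply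
      (α.codRestrict (LinearMap.range i) (fun x => (hex _).1 (hα x)) x))
  constructor
  · intro β β' hβ
    have hβ (x : P) : β (σ.hom x) = β' (σ.hom x) := DFunLike.congr_fun hβ x
    have h1 : π.comp (β - β') = 0 := hM.1 (by
      ext x
      simp [hβ])
    obtain ⟨δ, hδ⟩ := lift (β - β') (DFunLike.congr_fun h1)
    have h2 : δ = 0 := hN.1 (by
      ext x
      apply hi
      simp [hδ, hβ])
    ext y
    have := hδ y
    rw [h2, LinearMap.zero_apply, map_zero, LinearMap.sub_apply] at this
    exact (sub_eq_zero.1 this.symm)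
  · intro α
    obtain ⟨γ, hγ⟩ := hM.2 (π.comp α)
    have hγ (x : P) : γ (σ.hom x) = π (α x) := DFunLike.congr_fun hγ x
    obtain ⟨γ', hγ'⟩ := Module.projective_lifting_property π γ hπ
    have hγ' (y : Q) : π (γ' y) = γ y := DFunLike.congr_fun hγ' y
    obtain ⟨δ, hδ⟩ := lift (α - γ'.comp σ.hom) (fun x => by simp [hγ, hγ'])
    obtain ⟨δ', hδσ⟩ := hN.2 δ
    have hδσ (x : P) : δ' (σ.hom x) = δ x := DFunLike.congr_fun hδσ x
    refine ⟨γ' + i.comp δ', ?_⟩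
    ext x
    simp [hδσ, hδ]

/-- If `E` is local for `σ`, then so is the endomorphism ring of the abelian group `E`. -/
theorem IsLocalFor.addMonoidEnd {E : Type u} [AddCommGroup E] [Module A E]
    (hE : IsLocalFor σ (RingHom.id A) E) :
    IsLocalFor σ (Module.toAddMonoidEnd A E) (AddMonoid.End E) := by
  have ev {X : ModuleCat.{u} A} (β : X →ₛₗ[Module.toAddMonoidEnd A E] AddMonoid.End E) (e : E) :
      ∃ γ : X →ₗ[A] E, ∀ x, γ x = β x e :=
    ⟨{ toFun := fun x => β x e
       map_add' := fun x y => by rw [map_add]; rfl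
       map_smul' := fun a x => by rw [LinearMap.map_smulₛₗ]; rfl }, fun _ => rfl⟩
  constructor
  · intro β β' hβ
    have hβ (x : P) : β (σ.hom x) = β' (σ.hom x) := DFunLike.congr_fun hβ x
    ext y e
    obtain ⟨γ, hγ⟩ := ev β e
    obtain ⟨γ', hγ'⟩ := ev β' e
    have : γ = γ' := hE.1 (by
      ext x
      simp [hγ, hγ', hβ])
    rw [← hγ, ← hγ', this]
  · intro α
    choose α' hα' using ev α
    choose β hβ using fun e => hE.2 (α' e)
    have hβ (e : E) (x : P) : β e (σ.hom x) = α x e :=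
      (DFunLike.congr_fun (hβ e) x).trans (hα' e x)
    have hadd (e e' : E) : β (e + e') = β e + β e' := hE.1 (by
      ext x
      simp [hβ])
    refine ⟨
      { toFun := fun y => AddMonoidHom.mk' (fun e => β e y) fun e e' => by rw [hadd]; rfl
        map_add' := fun y y' => by ext e; exact map_add (β e) y y'
        map_smul' := fun a y => by ext e; exact map_smul (β e) a y }, ?_⟩
    ext x e
    exact hβ e x

theorem IsLocalFor.restrictScalars {B : Type u} [Ring B] {f : A →+* B} {M : ModuleCat.{u} B}
    (hM : IsLocalFor σ f M) :
    IsLocalFor σ (RingHom.id A) ((ModuleCat.restrictScalars f).obj M) := by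
  let e {X : ModuleCat.{u} A} (β : X →ₗ[A] (ModuleCat.restrictScalars f).obj M) : X →ₛₗ[f] M :=
    { toFun := fun x => β x
      map_add' := β.map_add
      map_smul' := β.map_smul }
  constructor
  · intro β β' hβ
    have : e β = e β' := hM.1 (by
      ext x
      exact DFunLike.congr_fun hβ x)
    ext y
    exact DFunLike.congr_fun this y
  · intro α
    obtain ⟨β, hβ⟩ := hM.2 (e α)
    refine ⟨
      { toFun := fun y => β y
        map_add' := β.map_add
        map_smul' := β.map_smulₛₗ }, ?_⟩
    ext x
    exact DFunLike.congr_fun hβ x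

variable {B : Type u} [Ring B] {f : A →+* B} {S : Set (Arrow (ModuleCat.{u} A))}

/-- An `A`-module that is local for all maps in `S` is a module over the localisation. -/
theorem IsUniversalLocalisationAt.exists_action (hf : IsUniversalLocalisationAt f S)
    {E : Type u} [AddCommGroup E] [Module A E]
    (hE : ∀ σ ∈ S, IsLocalFor σ.hom (RingHom.id A) E) :
    ∃ h : B →+* AddMonoid.End E, ∀ a e, h (f a) e = a • e := by
  obtain ⟨h, hh, -⟩ := hf.existsUnique_lift (AddMonoid.End E) (Module.toAddMonoidEnd A E)
    fun σ hσ => (hE σ hσ).addMonoidEnd.inverts_of_fgProj (hf.fgProj σ hσ)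
  exact ⟨h, fun a e => DFunLike.congr_fun (DFunLike.congr_fun hh a) e⟩

/-- Extensions of `B` by a `B`-module in the category of `A`-modules split. -/
theorem IsUniversalLocalisationAt.exists_retraction (hf : IsUniversalLocalisationAt f S)
    (hepi : IsRingEpi f) (N : ModuleCat.{u} B) {E : Type u} [AddCommGroup E] [Module A E]
    {i : (ModuleCat.restrictScalars f).obj N →ₗ[A] E} {π : E →ₗ[A] leftMod f}
    (hi : Function.Injective i) (hπ : Function.Surjective π) (hex : Function.Exact i π) :
    ∃ r : E →ₗ[A] (ModuleCat.restrictScalars f).obj N, ∀ n, r (i n) = n := by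
  obtain ⟨h, hh⟩ := hf.exists_action (E := E) fun σ hσ => by
    obtain ⟨-, -, _⟩ := hf.fgProj σ hσ
    exact IsLocalFor.extension hi hπ hex
      (isLocalFor_of_inverts (hf.inverts σ hσ) N).restrictScalars
      (isLocalFor_of_inverts (hf.inverts σ hσ) (ModuleCat.of B B)).restrictScalars
  obtain ⟨e, he⟩ := hπ (show leftMod f from (1 : B))
  let s : leftMod f →ₗ[A] E :=
    { toFun := fun b => h b e
      map_add' := fun b b' => by
        refine (DFunLike.congr_fun (map_add h b b') e).trans ?_
        rfl
      map_smul' := fun a b => by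
        refine (DFunLike.congr_fun (map_mul h (f a) b) e).trans ?_
        exact hh a _ }
  have hs (b : leftMod f) : π (s b) = b := by
    have h1 := hepi.map_smul (M := B) (N := B) (π.comp s).toAddMonoidHom
      (fun a b => (π.comp s).map_smul a b) b (1 : B)
    have h2 : π (s (show leftMod f from (1 : B))) = (show leftMod f from (1 : B)) := by
      refine Eq.trans ?_ he
      exact congrArg π (DFunLike.congr_fun (map_one h) e)
    have h3 : (show B from b) • (1 : B) = b := mul_one _
    rw [h3] at h1
    refine h1.trans ?_
    exact (congrArg ((show B from b) * ·) h2).trans (mul_one _)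
  have hrange (x : E) : (LinearMap.id - s.comp π : E →ₗ[A] E) x ∈ LinearMap.range i :=
    (hex _).1 (by simp [hs])
  refine ⟨(LinearEquiv.ofInjective i hi).symm.toLinearMap.comp
    ((LinearMap.id - s.comp π).codRestrict (LinearMap.range i) hrange), fun n => ?_⟩
  rw [LinearMap.comp_apply, LinearEquiv.coe_coe, LinearEquiv.symm_apply_eq]
  refine Subtype.ext ?_
  simp [hex.apply_apply_eq_zero]

/-- Given `0 → P → Q → B → 0`, every map from `P` to a `B`-module extends to `Q`. -/
theorem IsUniversalLocalisationAt.exists_extension (hf : IsUniversalLocalisationAt f S)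
    (hepi : IsRingEpi f) {d : P ⟶ Q} {ε : Q ⟶ leftMod f}
    (hd : Function.Injective d.hom) (hε : Function.Surjective ε.hom)
    (hdε : Function.Exact d.hom ε.hom) (N : ModuleCat.{u} B)
    (α : P →ₗ[A] (ModuleCat.restrictScalars f).obj N) :
    ∃ β : Q →ₗ[A] (ModuleCat.restrictScalars f).obj N, ∀ x, β (d.hom x) = α x := by
  let N' := (ModuleCat.restrictScalars f).obj N
  let W : Submodule A (N' × Q) := LinearMap.range (α.prod (-d.hom))
  let i : N' →ₗ[A] (N' × Q) ⧸ W := W.mkQ.comp (LinearMap.inl A N' Q)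
  let j : Q →ₗ[A] (N' × Q) ⧸ W := W.mkQ.comp (LinearMap.inr A N' Q)
  let π : ((N' × Q) ⧸ W) →ₗ[A] leftMod f := W.liftQ (ε.hom.comp (LinearMap.snd A N' Q)) (by
    rintro _ ⟨x, rfl⟩
    simp [hdε.apply_apply_eq_zero])
  have hij (x : P) : j (d.hom x) = i (α x) := by
    refine ((Submodule.Quotient.eq W).2 ⟨-x, ?_⟩)
    ext <;> simp
  have hi : Function.Injective i := by
    refine (injective_iff_map_eq_zero i).2 fun n hn => ?_
    obtain ⟨x, hx⟩ := (Submodule.Quotient.mk_eq_zero W).1 hn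
    have h1 : -d.hom x = 0 := congrArg Prod.snd hx
    have h2 : α x = n := congrArg Prod.fst hx
    rw [neg_eq_zero] at h1
    rw [← h2, (injective_iff_map_eq_zero d.hom).1 hd x h1, map_zero]
  have hπ : Function.Surjective π := fun b => by
    obtain ⟨y, rfl⟩ := hε b
    exact ⟨j y, rfl⟩
  have hex : Function.Exact i π := by
    intro t
    constructor
    · intro ht
      obtain ⟨⟨n, y⟩, rfl⟩ := Submodule.Quotient.mk_surjective _ t
      obtain ⟨x, rfl⟩ := (hdε y).1 ht
      refine ⟨n + α x, ?_⟩
      rw [map_add, ← hij]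
      refine (map_add W.mkQ (n, 0) (0, d.hom x)).symm.trans ?_
      simp
    · rintro ⟨n, rfl⟩
      exact map_zero ε.hom
  obtain ⟨r, hr⟩ := hf.exists_retraction hepi N hi hπ hex
  exact ⟨r.comp j, fun x => by rw [LinearMap.comp_apply, hij, hr]⟩

theorem IsUniversalLocalisationAt.tensor_injective (hf : IsUniversalLocalisationAt f S)
    (hepi : IsRingEpi f) {d : P ⟶ Q} {ε : Q ⟶ leftMod f}
    (hd : Function.Injective d.hom) (hε : Function.Surjective ε.hom)
    (hdε : Function.Exact d.hom ε.hom) :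
    Function.Injective (TensorOver.map (rightMod f) d) := by
  obtain ⟨β, hβ⟩ := hf.exists_extension hepi hd hε hdε (ModuleCat.of B (BaseChange f P))
    { toFun := fun x => BaseChange.unit f P x
      map_add' := (BaseChange.unit f P).map_add
      map_smul' := (BaseChange.unit f P).map_smulₛₗ }
  let β' : Q →ₛₗ[f] BaseChange f P :=
    { toFun := fun y => β y
      map_add' := β.map_add
      map_smul' := β.map_smul }
  have hβ' (x : P) : β' (d.hom x) = BaseChange.unit f P x := hβ x
  have h1 : (BaseChange.lift β').comp (BaseChange.map f d) = LinearMap.id :=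
    BaseChange.hom_ext fun x => by simp [hβ']
  have h2 : Function.Injective (BaseChange.map f d) :=
    Function.LeftInverse.injective (g := BaseChange.lift β') (DFunLike.congr_fun h1)
  intro s t hst
  exact h2 ((BaseChange.map_apply f d s).trans (hst.trans (BaseChange.map_apply f d t).symm))

theorem IsOneFinite.isHomological (hf : IsOneFinite f) (hS : IsUniversalLocalisationAt f S) :
    IsHomological f := by
  refine ⟨hf.epi, fun n hn => ?_⟩
  obtain ⟨P, Q, g, hg⟩ := hf.exists_resolvesCone
  obtain ⟨p, q, hi, hs, he⟩ := hg.exists_exact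
  obtain ⟨⟨_, _⟩, _, _⟩ := hg.1
  have : Projective P := (IsProjective.iff_projective P).1 inferInstance
  have := projective_prod_self Q
  obtain _ | _ | n := n
  · exact absurd hn (lt_irrefl 0)
  · exact (isZero_torGroup_one_iff _ _ hi hs he _).2 (hS.tensor_injective hf.epi hi hs he)
  · exact isZero_torGroup_add_two _ _ hi hs he n _

end Extensions

end RingEpi

theorem theorem3p2 {A B : Type u} [Ring A] [Ring B] (f : A →+* B)
    (hf : RingEpi.IsOneFinite f) :
    (RingEpi.IsHomological f ↔ RingEpi.IsUniversalLocalisation f) ∧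
    (∃ (P Q : ModuleCat.{u} A) (g : P ⟶ Q), RingEpi.ResolvesCone f g) ∧
    (RingEpi.IsHomological f →
      ∀ (P Q : ModuleCat.{u} A) (g : P ⟶ Q), RingEpi.ResolvesCone f g →
        RingEpi.IsUniversalLocalisationAt f {CategoryTheory.Arrow.mk g}) := by
  refine ⟨⟨fun h => ?_, fun ⟨S, hS⟩ => hf.isHomological hS⟩, hf.exists_resolvesCone,
    fun h P Q g hg => h.isUniversalLocalisationAt hg⟩
  obtain ⟨P, Q, g, hg⟩ := hf.exists_resolvesCone
  exact ⟨_, h.isUniversalLocalisationAt hg⟩
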